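/- Let $m\ge 2$ and let $\Omega\subset\{1,\dots,m\}^{\mathbb Z}$ be an Arnoux--Rauzy subshift with shift $(T\omega)(n)=\omega(n+1)$; that is, $\Omega$ is closed and shift-invariant, every orbit $\{T^n\omega:n\in\mathbb Z\}$ is dense in $\Omega$, and, writing $\mathcal W(\Omega)$ for the set of finite words occurring in elements of $\Omega$ (including the empty word), for every $n\ge 0$ there are exactly one right-special word $r_n$ and exactly one left-special word $l_n$ of length $n$, and $r_na\in\mathcal W(\Omega)$ and $al_n\in\mathcal W(\Omega)$ for every letter $a$. Here a word $w\in\mathcal W(\Omega)$ is right-special (left-special) if $wa,wb\in\mathcal W(\Omega)$ (respectively $aw,bw\in\mathcal W(\Omega)$) for two distinct letters $a,b$, and bispecial if it is both. Let $\epsilon=w_1,w_2,\dots$ be the bispecial words of $\Omega$ in order of increasing length, and let $(i_n)_{n\ge1}$ be the index sequence of $\Omega$, i.e. $i_n$ is the letter such that $w_ni_n$ is left-special. For a $T$-invariant probability measure $\nu$ on $\Omega$ put $\eta_\nu(n)=\min\{\nu(V_w):w\in\mathcal W(\Omega),\ |w|=n\}$, where $V_w=\{\omega\in\Omega:\omega(1)\cdots\omega(|w|)=w\}$.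 Suppose that there are $N\in\mathbb N$ and a sequence $k_j\to\infty$ such that each of the words $i_{k_j}i_{k_j+1}\cdots i_{k_j+N-1}$ contains all letters $1,\dots,m$. Then $\Omega$ satisfies Boshernitzan's condition (B): there is an ergodic probability measure $\nu$ on $\Omega$ with $\limsup_{n\to\infty}n\,\eta_\nu(n)>0$. Moreover, $\Omega$ has exactly one $T$-invariant probability measure $\mu$, and $$\limsup_{n\to\infty} n\,\eta_\mu(n)\ \ge\ 2^{-N}.$$ -/

import Mathlib

open Filter MeasureTheory
open scoped ENNReal

noncomputable section

namespace ArnouxRauzy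

/-- Two-sided subshifts over the alphabet `Fin m` (discrete topology): closed, shift-invariant
subsets of `ℤ → Fin m`. -/
abbrev Subshift (m : ℕ) : Type := SymbolicDynamics.FullShift.Subshift (Fin m) ℤ

variable {m : ℕ}

/-- The shift `(T ω)(n) = ω (n + 1)`, as a map of the subshift to itself. -/
def shift (Ω : Subshift m) : Ω.carrier → Ω.carrier :=
  (Ω.mapsTo 1).restrict

/-- The word `ω(k) ω(k+1) ⋯ ω(k+n-1)`. -/
def factor (ω : ℤ → Fin m) (k : ℤ) (n : ℕ) : List (Fin m) :=
  List.ofFn (fun j : Fin n => ω (k + (j : ℤ)))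

/-- The set `𝒲(Ω)` of words occurring in elements of `Ω` (the empty word included). -/
def words (Ω : Subshift m) : Set (List (Fin m)) :=
  {w | ∃ ω ∈ Ω.carrier, ∃ (k : ℤ) (n : ℕ), factor ω k n = w}

/-- The cylinder `V_w = {ω ∈ Ω : ω(1) ⋯ ω(|w|) = w}`. -/
def cyl (Ω : Subshift m) (w : List (Fin m)) : Set Ω.carrier :=
  {ω | factor ω.1 1 w.length = w}

/-- Every two-sided orbit `{T^n ω : n ∈ ℤ}` is dense in `Ω`. -/
def IsMinimal (Ω : Subshift m) : Prop :=
  ∀ ω ∈ Ω.carrier,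
    Ω.carrier ⊆ closure (Set.range fun n : ℤ => (fun k : ℤ => ω (n + k)))

/-- `w` has two distinct right extensions in the language of `Ω`. -/
def RightSpecial (Ω : Subshift m) (w : List (Fin m)) : Prop :=
  w ∈ words Ω ∧ ∃ a b : Fin m, a ≠ b ∧ w ++ [a] ∈ words Ω ∧ w ++ [b] ∈ words Ω

/-- `w` has two distinct left extensions in the language of `Ω`. -/
def LeftSpecial (Ω : Subshift m) (w : List (Fin m)) : Prop :=
  w ∈ words Ω ∧ ∃ a b : Fin m, a ≠ b ∧ a :: w ∈ words Ω ∧ b :: w ∈ words Ω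

def Bispecial (Ω : Subshift m) (w : List (Fin m)) : Prop :=
  RightSpecial Ω w ∧ LeftSpecial Ω w

/-- An Arnoux–Rauzy subshift over `m` letters: a minimal subshift which has, for every length
`n ≥ 0`, a unique right-special word and a unique left-special word of length `n`, both with all
`m` possible extensions. -/
structure IsArnouxRauzy (Ω : Subshift m) : Prop where
  minimal : IsMinimal Ω
  right : ∀ n : ℕ, ∃ r : List (Fin m), r.length = n ∧ RightSpecial Ω r ∧
    (∀ u : List (Fin m), u.length = n → RightSpecial Ω u → u = r) ∧
    ∀ a : Fin m, r ++ [a] ∈ words Ω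
  left : ∀ n : ℕ, ∃ l : List (Fin m), l.length = n ∧ LeftSpecial Ω l ∧
    (∀ u : List (Fin m), u.length = n → LeftSpecial Ω u → u = l) ∧
    ∀ a : Fin m, a :: l ∈ words Ω

/-- `i` is the index sequence of `Ω`: if `w 0, w 1, …` is the list of all bispecial words in order
of increasing length, then `w n` followed by the letter `i n` is left-special, for every `n`.
Numbering starts at `0`, so that `w 0` is the empty word for an Arnoux–Rauzy subshift. -/
def IsIndexSequence (Ω : Subshift m) (i : ℕ → Fin m) : Prop :=
  ∃ w : ℕ → List (Fin m),
    Set.range w = {u | Bispecial Ω u} ∧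
    StrictMono (fun n => (w n).length) ∧
    ∀ n, LeftSpecial Ω (w n ++ [i n])

/-- `η_ν(n) = min {ν(V_w) : w ∈ 𝒲(Ω), |w| = n}`; for nonempty `Ω` this is an infimum over a finite
nonempty set, hence a minimum. -/
def eta (Ω : Subshift m) (ν : Measure Ω.carrier) (n : ℕ) : ℝ≥0∞ :=
  ⨅ w ∈ {w : List (Fin m) | w ∈ words Ω ∧ w.length = n}, ν (cyl Ω w)

/-- `limsup_{n → ∞} n · η_ν(n)`. -/
def limsupEta (Ω : Subshift m) (ν : Measure Ω.carrier) : ℝ≥0∞ :=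
  limsup (fun n : ℕ => (n : ℝ≥0∞) * eta Ω ν n) atTop

/-- Boshernitzan's condition (B): there is an ergodic probability measure `ν` on `Ω` with
`limsup n · η_ν(n) > 0`. -/
def ConditionB (Ω : Subshift m) : Prop :=
  ∃ ν : Measure Ω.carrier, IsProbabilityMeasure ν ∧ Ergodic (shift Ω) ν ∧ 0 < limsupEta Ω ν

/-- `ν` is a `T`-invariant probability measure on `Ω`. -/
def IsInvariantProb (Ω : Subshift m) (ν : Measure Ω.carrier) : Prop :=
  IsProbabilityMeasure ν ∧ MeasurePreserving (shift Ω) ν ν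

end ArnouxRauzy

end

/-! ### Invariant and ergodic measures -/

/-! A bispecial word `w n` extends to `w (n + 1)` in at most two ways. If the next letter is `i n`,
nothing is right-special until `w (n + 1)` has been read to the right. If it is another letter,
nothing relevant is left-special until `w (n + 1)` has been read to the left. Hence ν(w_n) ≤ 2
ν(w_{n+1}) for every invariant ν, writing ν(u) for the measure of the cylinder of u. By induction,
`w n` also recurs in every window of |w_n| + 1 positions, so (|w_n| + 1) ν(w_n) ≥ 1.

Let u be a word of length |w_k| + 1. Looking back to the last `w k` at or before u gives ν(u) ≤
ν(w_k), and also a letter a such that w_k a forces u. If a = i_{k+r} with r < N, then w_{k+r+1}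
contains w_k a, whence ν(w_k) ≤ 2^{r+1} ν(w_{k+r+1}) ≤ 2^N ν(u). With the covering bound this gives
n η(n) ≥ 2^{-N} for n = |w_k| + 1.

All words of this length thus have the same measure up to a factor 2^N. Since their measures sum to
1, any two invariant probability measures agree on these cylinders up to a factor 4^N. As the
lengths are unbounded, all invariant measures are mutually absolutely continuous; so each is
ergodic, and there is only one. -/

section Dynamics

open scoped Topology BoundedContinuousFunction

/-- The **Krylov–Bogolyubov theorem**: a continuous self-map of a nonempty compact space, on which
Borel probability measures are determined by continuous functions, has an invariant probability
measure. -/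
theorem exists_measurePreserving_of_continuous {X : Type*} [TopologicalSpace X] [T2Space X]
    [CompactSpace X] [MeasurableSpace X] [BorelSpace X] [HasOuterApproxClosed X] [Nonempty X]
    {f : X → X} (hf : Continuous f) :
    ∃ μ : Measure X, IsProbabilityMeasure μ ∧ MeasurePreserving f μ μ := by
  obtain ⟨x⟩ := ‹Nonempty X›
  let ν : ℕ → Measure X := fun n =>
    ((n + 1 : ℕ) : ℝ≥0∞)⁻¹ • ∑ j ∈ Finset.range (n + 1), Measure.dirac (f^[j] x)
  have hν : ∀ n, IsProbabilityMeasure (ν n) := fun n => by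
    constructor
    simp only [ν, Measure.smul_apply, Measure.finsetSum_apply, measure_univ, smul_eq_mul,
      Finset.sum_const, Finset.card_range, nsmul_eq_mul, mul_one]
    exact ENNReal.inv_mul_cancel (by simp) (ENNReal.natCast_ne_top _)
  have hint : ∀ (n : ℕ) (g : X →ᵇ ℝ), ∫ y, g y ∂(ν n) =
      ((n + 1 : ℕ) : ℝ)⁻¹ * ∑ j ∈ Finset.range (n + 1), g (f^[j] x) := fun n g => by
    rw [integral_smul_measure, integral_finsetSum_measure fun j _ => g.integrable _]
    simp only [integral_dirac, ENNReal.toReal_inv, ENNReal.toReal_natCast, smul_eq_mul]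
  let P : ℕ → ProbabilityMeasure X := fun n => ⟨ν n, hν n⟩
  -- A limit along an ultrafilter needs only compactness of the space of probability measures, not
  -- sequential compactness.
  obtain ⟨μ, -, hμ⟩ := isCompact_univ.ultrafilter_le_nhds ((Ultrafilter.of atTop).map P)
    (by simp)
  have hlim : Tendsto P (Ultrafilter.of (atTop : Filter ℕ)) (𝓝 μ) := hμ
  rw [ProbabilityMeasure.tendsto_iff_forall_integral_tendsto] at hlim
  refine ⟨μ, inferInstance, hf.measurable, ?_⟩
  have : IsProbabilityMeasure (Measure.map f (μ : Measure X)) :=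
    Measure.isProbabilityMeasure_map hf.aemeasurable
  refine ext_of_forall_integral_eq_of_IsFiniteMeasure fun g => ?_
  rw [integral_map hf.aemeasurable g.continuous.aestronglyMeasurable]
  let g' : X →ᵇ ℝ := g.compContinuous ⟨f, hf⟩
  have h1 := (hlim g').sub (hlim g)
  have h2 : Tendsto (fun n : ℕ => ∫ y, g' y ∂(ν n) - ∫ y, g y ∂(ν n)) atTop (𝓝 0) := by
    have hb : ∀ n : ℕ, ‖∫ y, g' y ∂(ν n) - ∫ y, g y ∂(ν n)‖ ≤ 2 * ‖g‖ * (1 / ((n : ℝ) + 1)) := by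
      intro n
      -- The two orbit sums telescope, leaving only the end terms.
      have hs : ∑ j ∈ Finset.range (n + 1), g' (f^[j] x) - ∑ j ∈ Finset.range (n + 1), g (f^[j] x)
          = g (f^[n + 1] x) - g x := by
        rw [← Finset.sum_sub_distrib]
        have := Finset.sum_range_sub (fun j => g (f^[j] x)) (n + 1)
        simp only [Function.iterate_zero, id] at this
        rw [← this]
        refine Finset.sum_congr rfl fun j _ => ?_
        rw [Function.iterate_succ_apply']
        rfl
      rw [hint, hint, ← mul_sub, hs, norm_mul, mul_comm, one_div, Nat.cast_add, Nat.cast_one]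
      have hn : ‖((n : ℝ) + 1)⁻¹‖ = ((n : ℝ) + 1)⁻¹ := by
        rw [Real.norm_of_nonneg]
        positivity
      rw [hn]
      gcongr
      calc ‖g (f^[n + 1] x) - g x‖ ≤ ‖g (f^[n + 1] x)‖ + ‖g x‖ := norm_sub_le _ _
        _ ≤ ‖g‖ + ‖g‖ := add_le_add (g.norm_coe_le_norm _) (g.norm_coe_le_norm _)
        _ = 2 * ‖g‖ := by ring
    refine squeeze_zero_norm hb ?_
    simpa using tendsto_one_div_add_atTop_nhds_zero_nat.const_mul (2 * ‖g‖)
  have h3 := tendsto_nhds_unique h1 (h2.mono_left (Ultrafilter.of_le atTop))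
  exact sub_eq_zero.1 h3

/-- If all invariant probability measures of `f` are absolutely continuous with respect to each
other, then they are ergodic. -/
theorem ergodic_of_forall_absolutelyContinuous {X : Type*} [MeasurableSpace X] {f : X → X}
    {μ : Measure X} [IsProbabilityMeasure μ] (hμ : MeasurePreserving f μ μ)
    (h : ∀ ν₁ ν₂ : Measure X, IsProbabilityMeasure ν₁ → MeasurePreserving f ν₁ ν₁ →
      IsProbabilityMeasure ν₂ → MeasurePreserving f ν₂ ν₂ → ν₁ ≪ ν₂) : Ergodic f μ := by
  have hcond : ∀ s, MeasurableSet s → f ⁻¹' s = s →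
      MeasurePreserving f (ProbabilityTheory.cond μ s) (ProbabilityTheory.cond μ s) := by
    intro s hs hfs
    have := hμ.restrict_preimage hs
    rw [hfs] at this
    exact this.smul_measure _
  refine ⟨hμ, ⟨fun s hs hfs => ?_⟩⟩
  rw [eventuallyConst_set']
  by_contra! hcon
  obtain ⟨h0, h1⟩ := hcon
  have hs0 : μ s ≠ 0 := fun h => h0 (ae_eq_empty.2 h)
  have hs1 : μ sᶜ ≠ 0 := fun h => h1 (ae_eq_univ.2 h)
  have hfs' : f ⁻¹' sᶜ = sᶜ := by rw [Set.preimage_compl, hfs]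
  -- Conditioning on an invariant set and on its complement would give two mutually singular
  -- invariant measures.
  have hac := h _ _ (ProbabilityTheory.cond_isProbabilityMeasure hs0) (hcond s hs hfs)
    (ProbabilityTheory.cond_isProbabilityMeasure hs1) (hcond _ hs.compl hfs')
  have hz : ProbabilityTheory.cond μ sᶜ s = 0 := by
    rw [ProbabilityTheory.cond_apply hs.compl]
    simp
  have := hac hz
  rw [ProbabilityTheory.cond_apply_self hs0 (measure_ne_top _ _)] at this
  exact one_ne_zero this

end Dynamics

namespace ArnouxRauzy

variable {m : ℕ} {Ω : Subshift m}

/-! ### Occurrences of words -/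

/-- The word `u` occurs in `ω` at position `p`. -/
def Occurs (ω : ℤ → Fin m) (p : ℤ) (u : List (Fin m)) : Prop :=
  factor ω p u.length = u

@[simp] theorem length_factor (ω : ℤ → Fin m) (p : ℤ) (n : ℕ) : (factor ω p n).length = n := by
  simp [factor]

theorem occurs_factor (ω : ℤ → Fin m) (p : ℤ) (n : ℕ) : Occurs ω p (factor ω p n) := by
  simp [Occurs]

theorem factor_add (ω : ℤ → Fin m) (p : ℤ) (a b : ℕ) :
    factor ω p (a + b) = factor ω p a ++ factor ω (p + a) b := by
  simp [factor, List.ofFn_add, add_assoc]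

theorem occurs_append {ω : ℤ → Fin m} {p : ℤ} {u v : List (Fin m)} :
    Occurs ω p (u ++ v) ↔ Occurs ω p u ∧ Occurs ω (p + u.length) v := by
  unfold Occurs
  rw [List.length_append, factor_add]
  constructor
  · intro h
    exact List.append_inj h (by simp)
  · rintro ⟨h₁, h₂⟩
    rw [h₁, h₂]

@[simp] theorem occurs_nil (ω : ℤ → Fin m) (p : ℤ) : Occurs ω p [] := by
  simp [Occurs, factor]

@[simp] theorem occurs_singleton {ω : ℤ → Fin m} {p : ℤ} {a : Fin m} :
    Occurs ω p [a] ↔ ω p = a := by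
  simp [Occurs, factor]

theorem mem_words_iff {u : List (Fin m)} :
    u ∈ words Ω ↔ ∃ ω ∈ Ω.carrier, ∃ p, Occurs ω p u := by
  constructor
  · rintro ⟨ω, hω, p, n, rfl⟩
    exact ⟨ω, hω, p, occurs_factor ω p n⟩
  · rintro ⟨ω, hω, p, h⟩
    exact ⟨ω, hω, p, _, h⟩

theorem Occurs.mem_words {ω : ℤ → Fin m} (hω : ω ∈ Ω.carrier) {p : ℤ} {u : List (Fin m)}
    (h : Occurs ω p u) : u ∈ words Ω :=
  mem_words_iff.2 ⟨ω, hω, p, h⟩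

theorem words_left {u v : List (Fin m)} (h : u ++ v ∈ words Ω) : u ∈ words Ω := by
  obtain ⟨ω, hω, p, h⟩ := mem_words_iff.1 h
  exact (occurs_append.1 h).1.mem_words hω

theorem words_right {u v : List (Fin m)} (h : u ++ v ∈ words Ω) : v ∈ words Ω := by
  obtain ⟨ω, hω, p, h⟩ := mem_words_iff.1 h
  exact (occurs_append.1 h).2.mem_words hω

/-! ### Special words -/

theorem RightSpecial.of_append {s u : List (Fin m)} (h : RightSpecial Ω (s ++ u)) :
    RightSpecial Ω u := by
  obtain ⟨h, a, b, hab, ha, hb⟩ := h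
  rw [List.append_assoc] at ha hb
  exact ⟨words_right h, a, b, hab, words_right ha, words_right hb⟩

theorem LeftSpecial.of_append {u s : List (Fin m)} (h : LeftSpecial Ω (u ++ s)) :
    LeftSpecial Ω u := by
  obtain ⟨h, a, b, hab, ha, hb⟩ := h
  rw [← List.cons_append] at ha hb
  exact ⟨words_left h, a, b, hab, words_left ha, words_left hb⟩

theorem IsArnouxRauzy.rightSpecial_unique (hΩ : IsArnouxRauzy Ω) {u v : List (Fin m)}
    (hu : RightSpecial Ω u) (hv : RightSpecial Ω v) (h : u.length = v.length) : u = v := by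
  obtain ⟨r, -, -, hr, -⟩ := hΩ.right u.length
  rw [hr u rfl hu, hr v h.symm hv]

theorem IsArnouxRauzy.leftSpecial_unique (hΩ : IsArnouxRauzy Ω) {u v : List (Fin m)}
    (hu : LeftSpecial Ω u) (hv : LeftSpecial Ω v) (h : u.length = v.length) : u = v := by
  obtain ⟨r, -, -, hr, -⟩ := hΩ.left u.length
  rw [hr u rfl hu, hr v h.symm hv]

theorem IsArnouxRauzy.rightSpecial_append_mem (hΩ : IsArnouxRauzy Ω) {u : List (Fin m)}
    (hu : RightSpecial Ω u) (a : Fin m) : u ++ [a] ∈ words Ω := by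
  obtain ⟨r, -, -, hr, hw⟩ := hΩ.right u.length
  rw [hr u rfl hu]
  exact hw a

theorem IsArnouxRauzy.bispecial_nil (hΩ : IsArnouxRauzy Ω) : Bispecial Ω [] := by
  obtain ⟨r, hr, hr', -⟩ := hΩ.right 0
  obtain ⟨l, hl, hl', -⟩ := hΩ.left 0
  rw [List.length_eq_zero_iff] at hr hl
  subst hr hl
  exact ⟨hr', hl'⟩

theorem IsArnouxRauzy.nonempty (hΩ : IsArnouxRauzy Ω) : Nonempty Ω.carrier := by
  obtain ⟨ω, hω, -⟩ := mem_words_iff.1 hΩ.bispecial_nil.1.1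
  exact ⟨⟨ω, hω⟩⟩

/-- If no proper prefix of `u ++ t` extending `u` is right-special, then every occurrence of `u`
extends to an occurrence of `u ++ t`. -/
theorem Occurs.extend_right {ω : ℤ → Fin m} (hω : ω ∈ Ω.carrier) {p : ℤ} {u : List (Fin m)}
    (hu : Occurs ω p u) (t : List (Fin m)) (ht : u ++ t ∈ words Ω)
    (h : ∀ s t', t = s ++ t' → t' ≠ [] → ¬ RightSpecial Ω (u ++ s)) : Occurs ω p (u ++ t) := by
  induction t using List.reverseRecOn with
  | nil => simpa using hu
  | append_singleton t a ih =>
    rw [← List.append_assoc] at ht ⊢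
    have hut := ih (words_left ht) fun s t' hs ht' =>
      h s (t' ++ [a]) (by rw [hs, List.append_assoc]) (by simp)
    have hb : Occurs ω p (u ++ t ++ [ω (p + (u ++ t).length)]) :=
      occurs_append.2 ⟨hut, occurs_singleton.2 rfl⟩
    by_cases hab : ω (p + (u ++ t).length) = a
    · rwa [hab] at hb
    · exact absurd ⟨words_left ht, _, _, hab, hb.mem_words hω, ht⟩ (h t [a] rfl (by simp))

/-- If no proper suffix of `t ++ u` extending `u` is left-special, then every occurrence of `u`
extends to an occurrence of `t ++ u`. -/
theorem Occurs.extend_left {ω : ℤ → Fin m} (hω : ω ∈ Ω.carrier) {u : List (Fin m)}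
    (t : List (Fin m)) {p : ℤ} (hu : Occurs ω (p + t.length) u) (ht : t ++ u ∈ words Ω)
    (h : ∀ t' s, t = t' ++ s → t' ≠ [] → ¬ LeftSpecial Ω (s ++ u)) : Occurs ω p (t ++ u) := by
  induction t generalizing p with
  | nil => simpa using hu
  | cons a t ih =>
    have htu : Occurs ω (p + 1) (t ++ u) := by
      refine ih ?_ (words_right (u := [a]) ht) fun t' s hs ht' =>
        h (a :: t') s (by rw [hs, List.cons_append]) (by simp)
      rw [List.length_cons] at hu
      convert hu using 1
      push_cast
      ring
    have hb : Occurs ω p ([ω p] ++ (t ++ u)) :=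
      occurs_append.2 ⟨occurs_singleton.2 rfl, by simpa using htu⟩
    by_cases hab : ω p = a
    · rwa [hab] at hb
    · exact absurd ⟨words_right (u := [a]) ht, _, _, hab, hb.mem_words hω, ht⟩
        (h [a] t rfl (by simp))

/-! ### The sequence of bispecial words -/

/-- `w` lists the bispecial words of `Ω` in order of increasing length, and `i` is the index
sequence of `Ω`. -/
structure IsBispecialSequence (Ω : Subshift m) (w : ℕ → List (Fin m)) (i : ℕ → Fin m) : Prop where
  range_eq : Set.range w = {u | Bispecial Ω u}
  strictMono : StrictMono fun n => (w n).length
  leftSpecial : ∀ n, LeftSpecial Ω (w n ++ [i n])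

namespace IsBispecialSequence

variable {w : ℕ → List (Fin m)} {i : ℕ → Fin m}

theorem bispecial (hw : IsBispecialSequence Ω w i) (n : ℕ) : Bispecial Ω (w n) := by
  have : w n ∈ Set.range w := ⟨n, rfl⟩
  rwa [hw.range_eq] at this

theorem zero_eq_nil (hΩ : IsArnouxRauzy Ω) (hw : IsBispecialSequence Ω w i) : w 0 = [] := by
  have h : [] ∈ Set.range w := by
    rw [hw.range_eq]
    exact hΩ.bispecial_nil
  obtain ⟨j, hj⟩ := h
  have := hw.strictMono.monotone (Nat.zero_le j)
  simpa [hj] using this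

theorem eq_of_bispecial (hw : IsBispecialSequence Ω w i) {n : ℕ} {s : List (Fin m)}
    (hs : Bispecial Ω s) (h₁ : (w n).length ≤ s.length) (h₂ : s.length < (w (n + 1)).length) :
    s = w n := by
  have h : s ∈ Set.range w := by
    rwa [hw.range_eq]
  obtain ⟨j, rfl⟩ := h
  have hj₁ : n ≤ j := hw.strictMono.le_iff_le.1 h₁
  have hj₂ : j < n + 1 := hw.strictMono.lt_iff_lt.1 h₂
  rw [show j = n by omega]

/-- Suffixes of right-special words are right-special, and there is only one of each length. The
next lemma is the dual statement for left-special prefixes. -/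
theorem exists_append_eq (hΩ : IsArnouxRauzy Ω) (hw : IsBispecialSequence Ω w i) {k n : ℕ}
    (hkn : k ≤ n) : ∃ t, t ++ w k = w n := by
  have hl : (w k).length ≤ (w n).length := hw.strictMono.monotone hkn
  have hsplit := List.take_append_drop ((w n).length - (w k).length) (w n)
  have hr := (hw.bispecial n).1
  rw [← hsplit] at hr
  have heq := hΩ.rightSpecial_unique (hw.bispecial k).1 hr.of_append (by simp; omega)
  exact ⟨_, (congrArg (_ ++ ·) heq).trans hsplit⟩

theorem exists_index_append_eq (hΩ : IsArnouxRauzy Ω) (hw : IsBispecialSequence Ω w i) (n : ℕ) :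
    ∃ t, w n ++ [i n] ++ t = w (n + 1) := by
  have hl : (w n).length < (w (n + 1)).length := hw.strictMono (Nat.lt_succ_self n)
  have hsplit := List.take_append_drop ((w n).length + 1) (w (n + 1))
  have hr := (hw.bispecial (n + 1)).2
  rw [← hsplit] at hr
  have heq := hΩ.leftSpecial_unique (hw.leftSpecial n) hr.of_append (by simp; omega)
  exact ⟨_, (congrArg (· ++ _) heq).trans hsplit⟩

/-- A prefix of `w (n + 1)` is left-special. Were a proper one extending `w n ++ [i n]` also
right-special, it would be a bispecial word of length strictly between those of `w n` and `w (n +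
1)`. So each further letter is forced. -/
theorem occurs_succ_of_eq (hΩ : IsArnouxRauzy Ω) (hw : IsBispecialSequence Ω w i) {n : ℕ}
    {ω : ℤ → Fin m} (hω : ω ∈ Ω.carrier) {p : ℤ} (h : Occurs ω p (w n ++ [i n])) :
    Occurs ω p (w (n + 1)) := by
  obtain ⟨t, ht⟩ := hw.exists_index_append_eq hΩ n
  rw [← ht]
  refine h.extend_right hω t (by rw [ht]; exact (hw.bispecial _).1.1) fun s t' hs ht' hR => ?_
  subst hs
  have hlen := congrArg List.length ht
  have := List.length_pos_iff.2 ht'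
  have hL : LeftSpecial Ω (w n ++ [i n] ++ s) := by
    have hB := (hw.bispecial (n + 1)).2
    rw [← ht, ← List.append_assoc] at hB
    exact hB.of_append
  simp only [List.length_append, List.length_singleton] at hlen
  have heq := congrArg List.length (hw.eq_of_bispecial ⟨hR, hL⟩ (n := n) (by simp) (by simp; omega))
  simp at heq

theorem occurs_succ_of_ne (hΩ : IsArnouxRauzy Ω) (hw : IsBispecialSequence Ω w i) {n : ℕ}
    {ω : ℤ → Fin m} (hω : ω ∈ Ω.carrier) {p : ℤ} {a : Fin m} (ha : a ≠ i n)
    (h : Occurs ω p (w n ++ [a])) :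
    Occurs ω (p - ((w (n + 1)).length - (w n).length : ℕ)) (w (n + 1)) := by
  obtain ⟨t, ht⟩ := hw.exists_append_eq hΩ (Nat.le_add_right n 1)
  have hlen := congrArg List.length ht
  simp only [List.length_append] at hlen
  have htl : (w (n + 1)).length - (w n).length = t.length := by
    omega
  rw [htl]
  have key : Occurs ω (p - t.length) (t ++ (w n ++ [a])) := by
    refine Occurs.extend_left hω t (by simpa using h) ?_ fun t' s hs ht' hL => ?_
    · rw [← List.append_assoc, ht]
      exact hΩ.rightSpecial_append_mem (hw.bispecial _).1 a
    · subst hs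
      have := List.length_pos_iff.2 ht'
      have hR : RightSpecial Ω (s ++ w n) := by
        have hB := (hw.bispecial (n + 1)).1
        rw [← ht, List.append_assoc] at hB
        exact hB.of_append
      -- This word is bispecial and shorter than `w (n + 1)`, so it can only be `w n`. Then `w n ++
      -- [a]` would be left-special, contradicting `a ≠ i n`.
      have hsn : s ++ w n = w n := by
        refine hw.eq_of_bispecial ⟨hR, ?_⟩ (by simp) ?_
        · rw [← List.append_assoc] at hL
          exact hL.of_append
        · rw [← ht]
          simp
          omega
      rw [← List.append_assoc, hsn] at hL
      have := hΩ.leftSpecial_unique hL (hw.leftSpecial n) (by simp)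
      simp at this
      exact ha this
  rw [← List.append_assoc, ht] at key
  exact (occurs_append.1 key).1

theorem occurs_succ (hΩ : IsArnouxRauzy Ω) (hw : IsBispecialSequence Ω w i) {n : ℕ}
    {ω : ℤ → Fin m} (hω : ω ∈ Ω.carrier) {p : ℤ} (h : Occurs ω p (w n)) :
    Occurs ω p (w (n + 1)) ∨
      Occurs ω (p - ((w (n + 1)).length - (w n).length : ℕ)) (w (n + 1)) := by
  have h' : Occurs ω p (w n ++ [ω (p + (w n).length)]) :=
    occurs_append.2 ⟨h, occurs_singleton.2 rfl⟩
  by_cases hi : ω (p + (w n).length) = i n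
  · rw [hi] at h'
    exact Or.inl (hw.occurs_succ_of_eq hΩ hω h')
  · exact Or.inr (hw.occurs_succ_of_ne hΩ hω hi h')

/-- Every window of `|w n| + 1` consecutive positions contains an occurrence of `w n`. -/
theorem exists_occurs (hΩ : IsArnouxRauzy Ω) (hw : IsBispecialSequence Ω w i) (n : ℕ)
    {ω : ℤ → Fin m} (hω : ω ∈ Ω.carrier) (q : ℤ) :
    ∃ d : ℕ, d ≤ (w n).length ∧ Occurs ω (q - d) (w n) := by
  induction n generalizing q with
  | zero =>
    rw [hw.zero_eq_nil hΩ]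
    exact ⟨0, le_rfl, occurs_nil _ _⟩
  | succ n ih =>
    have hl : (w n).length < (w (n + 1)).length := hw.strictMono (Nat.lt_succ_self n)
    obtain ⟨d, hd, h⟩ := ih q
    rcases hw.occurs_succ hΩ hω h with h | h
    · exact ⟨d, by omega, h⟩
    -- The step back by the difference of lengths is exactly what the longer window allows.
    · refine ⟨d + ((w (n + 1)).length - (w n).length), by omega, ?_⟩
      rw [Nat.cast_add, ← sub_sub]
      exact h

/-- The last occurrence of `w n` at or before the position `q`. -/
theorem exists_last_occurs (hΩ : IsArnouxRauzy Ω) (hw : IsBispecialSequence Ω w i) (n : ℕ)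
    {ω : ℤ → Fin m} (hω : ω ∈ Ω.carrier) (q : ℤ) :
    ∃ d : ℕ, Occurs ω (q - d) (w n) ∧ ∀ e < d, ¬ Occurs ω (q - e) (w n) := by
  classical
  obtain ⟨d, -, h⟩ := hw.exists_occurs hΩ n hω q
  have hex : ∃ d : ℕ, Occurs ω (q - d) (w n) := ⟨d, h⟩
  exact ⟨Nat.find hex, Nat.find_spec hex, fun e he => Nat.find_min hex he⟩

/-- Every occurrence of a suitable word `w n ++ [a]` forces a subsequent occurrence of `u`. -/
theorem exists_occurs_of_occurs_append (hΩ : IsArnouxRauzy Ω) (hw : IsBispecialSequence Ω w i)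
    (n : ℕ) {u : List (Fin m)} (hu : u ∈ words Ω) (hul : u.length = (w n).length + 1) :
    ∃ (a : Fin m) (d : ℕ), ∀ ω ∈ Ω.carrier, ∀ p,
      Occurs ω p (w n ++ [a]) → Occurs ω (p + d) u := by
  obtain ⟨ξ, hξ, q, hq⟩ := mem_words_iff.1 hu
  obtain ⟨d, hd, hmax⟩ := hw.exists_last_occurs hΩ n hξ q
  -- Since `u` has length `(w n).length + 1`, the word `w n ++ [a] ++ t` ends exactly where the
  -- occurrence of `u` at `q` ends.
  set t := factor ξ (q - d + ((w n).length + 1 : ℕ)) d with ht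
  have hx : factor ξ (q - d) ((w n).length + 1 + d) =
      w n ++ [ξ (q - d + (w n).length)] ++ t := by
    rw [factor_add, factor_add, show factor ξ (q - d) (w n).length = w n from hd]
    simp [factor, ht]
  have hx' : factor ξ (q - d) (d + u.length) = factor ξ (q - d) d ++ u := by
    rw [factor_add, sub_add_cancel, show factor ξ q u.length = u from hq]
  have hX := occurs_factor ξ (q - d) ((w n).length + 1 + d)
  rw [hx] at hX
  refine ⟨ξ (q - d + (w n).length), d, fun ω hω p hp => ?_⟩
  have hext : Occurs ω p (w n ++ [ξ (q - d + (w n).length)] ++ t) := by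
    refine hp.extend_right hω t (hX.mem_words hξ) fun s t' hs ht' hR => ?_
    have htl : s.length + t'.length = d := by
      have := congrArg List.length hs
      simpa [ht] using this.symm
    have hpos := List.length_pos_iff.2 ht'
    rw [hs, ← List.append_assoc] at hX
    have hY := (occurs_append.1 hX).1
    set y := w n ++ [ξ (q - d + (w n).length)] ++ s with hy
    have hyl : y.length = (w n).length + 1 + s.length := by simp [hy]; omega
    rw [← List.take_append_drop (s.length + 1) y] at hR hY
    -- A right-special prefix would end in `w n`, giving an occurrence at `q - (t'.length - 1)`,
    -- later than the last one.
    have heq := hΩ.rightSpecial_unique hR.of_append (hw.bispecial n).1 (by simp; omega)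
    rw [heq] at hY
    refine hmax (t'.length - 1) (by omega) ?_
    convert (occurs_append.1 hY).2 using 1
    rw [List.length_take, min_eq_left (by omega)]
    omega
  rw [← hx, hul.symm, add_comm, hx'] at hext
  simpa using (occurs_append.1 hext).2

/-- Every occurrence of `u` is preceded by an occurrence of `w n` at a fixed distance. -/
theorem exists_occurs_of_occurs (hΩ : IsArnouxRauzy Ω) (hw : IsBispecialSequence Ω w i)
    (n : ℕ) {u : List (Fin m)} (hu : u ∈ words Ω) (hul : (w n).length ≤ u.length) :
    ∃ d : ℕ, ∀ ω ∈ Ω.carrier, ∀ p, Occurs ω p u → Occurs ω (p - d) (w n) := by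
  obtain ⟨ξ, hξ, q, hq⟩ := mem_words_iff.1 hu
  obtain ⟨d, hd, hmax⟩ := hw.exists_last_occurs hΩ n hξ q
  set t := factor ξ (q - d) d with ht
  have htl : t.length = d := by simp [ht]
  have hX : Occurs ξ (q - d) (t ++ u) :=
    occurs_append.2 ⟨occurs_factor _ _ _, by rwa [htl, sub_add_cancel]⟩
  refine ⟨d, fun ω hω p hp => ?_⟩
  have hext : Occurs ω (p - d) (t ++ u) := by
    refine Occurs.extend_left hω t (by rwa [htl, sub_add_cancel]) (hX.mem_words hξ)
      fun t' s hs ht' hL => ?_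
    have hpos := List.length_pos_iff.2 ht'
    have hsl : t'.length + s.length = d := by
      rw [← htl, hs, List.length_append]
    rw [hs, List.append_assoc] at hX
    have hY := (occurs_append.1 hX).2
    rw [← List.take_append_drop (w n).length (s ++ u)] at hL hY
    -- A left-special suffix would begin with `w n`, giving an occurrence at `q - s.length`, again
    -- too late.
    have heq := hΩ.leftSpecial_unique hL.of_append (hw.bispecial n).2 (by simp; omega)
    rw [heq] at hY
    refine hmax s.length (by omega) ?_
    convert (occurs_append.1 hY).1 using 1
    omega
  have hfac : (t ++ u).take (w n).length = w n := by
    have h := hX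
    rw [← List.take_append_drop (w n).length (t ++ u)] at h
    have h1 := (occurs_append.1 h).1
    have hlt : ((t ++ u).take (w n).length).length = (w n).length := by simp; omega
    unfold Occurs at h1 hd
    rw [hlt, hd] at h1
    exact h1.symm
  rw [← List.take_append_drop (w n).length (t ++ u), hfac] at hext
  exact (occurs_append.1 hext).1

end IsBispecialSequence

end ArnouxRauzy

namespace ArnouxRauzy

variable {m : ℕ} {Ω : Subshift m}

/-! ### Cylinders and invariant measures -/

theorem continuous_shift (Ω : Subshift m) : Continuous (shift Ω) :=
  (SymbolicDynamics.FullShift.continuous_shift (1 : ℤ)).restrict _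

/-- The cylinder of the elements of `Ω` in which `u` occurs at position `p`. -/
def cylAt (Ω : Subshift m) (p : ℤ) (u : List (Fin m)) : Set Ω.carrier :=
  {ω | Occurs ω.1 p u}

theorem measurable_factor (p : ℤ) (n : ℕ) :
    Measurable fun ω : Ω.carrier => fun j : Fin n => ω.1 (p + (j : ℤ)) :=
  measurable_pi_lambda _ fun _ => (measurable_pi_apply _).comp measurable_subtype_coe

theorem cylAt_ofFn (p : ℤ) {n : ℕ} (b : Fin n → Fin m) :
    cylAt Ω p (List.ofFn b) =
      (fun ω : Ω.carrier => fun j : Fin n => ω.1 (p + (j : ℤ))) ⁻¹' {b} := by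
  ext ω
  simp only [cylAt, Occurs, List.length_ofFn, Set.mem_ofPred_eq, Set.mem_preimage,
    Set.mem_singleton_iff]
  exact List.ofFn_inj

theorem measurableSet_cylAt (p : ℤ) (u : List (Fin m)) : MeasurableSet (cylAt Ω p u) := by
  rw [← List.ofFn_get u, cylAt_ofFn]
  exact measurable_factor _ _ (measurableSet_singleton _)

theorem shift_preimage_cylAt (p : ℤ) (u : List (Fin m)) :
    shift Ω ⁻¹' cylAt Ω p u = cylAt Ω (p + 1) u := by
  ext ω
  have : factor (shift Ω ω).1 p u.length = factor ω.1 (p + 1) u.length := by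
    refine congrArg List.ofFn (funext fun j => congrArg ω.1 ?_)
    ring
  change factor (shift Ω ω).1 p u.length = u ↔ factor ω.1 (p + 1) u.length = u
  rw [this]

theorem IsInvariantProb.measure_cylAt {ν : Measure Ω.carrier} (hν : IsInvariantProb Ω ν) (p : ℤ)
    (u : List (Fin m)) : ν (cylAt Ω p u) = ν (cyl Ω u) := by
  have hstep : ∀ p, ν (cylAt Ω (p + 1) u) = ν (cylAt Ω p u) := fun p => by
    rw [← shift_preimage_cylAt, hν.2.measure_preimage (measurableSet_cylAt p u).nullMeasurableSet]
  have h0 : ∀ p, ν (cylAt Ω p u) = ν (cylAt Ω 0 u) := fun p => by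
    induction p using Int.induction_on with
    | zero => rfl
    | succ p ih => rw [hstep, ih]
    | pred p ih => rw [← ih, ← hstep, sub_add_cancel]
  exact (h0 p).trans (h0 1).symm

theorem IsInvariantProb.measure_cyl_le {ν : Measure Ω.carrier} (hν : IsInvariantProb Ω ν)
    {u v : List (Fin m)} (d : ℤ)
    (h : ∀ ω ∈ Ω.carrier, ∀ p, Occurs ω p u → Occurs ω (p + d) v) :
    ν (cyl Ω u) ≤ ν (cyl Ω v) := by
  rw [← hν.measure_cylAt 0 u, ← hν.measure_cylAt (0 + d) v]
  exact measure_mono fun ω hω => h ω.1 ω.2 0 hω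

theorem cyl_eq_empty {u : List (Fin m)} (hu : u ∉ words Ω) : cyl Ω u = ∅ :=
  Set.eq_empty_iff_forall_notMem.2 fun ω hω => hu ⟨ω.1, ω.2, 1, _, hω⟩

theorem IsInvariantProb.sum_measure_cyl {ν : Measure Ω.carrier} (hν : IsInvariantProb Ω ν)
    (n : ℕ) : ∑ b : Fin n → Fin m, ν (cyl Ω (List.ofFn b)) = 1 := by
  have := hν.1
  rw [← measure_univ (μ := ν), ← Set.preimage_univ
    (f := fun ω : Ω.carrier => fun j : Fin n => ω.1 (0 + (j : ℤ))), ← Finset.coe_univ,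
    ← sum_measure_preimage_singleton _
      fun b _ => measurable_factor _ _ (measurableSet_singleton b)]
  refine Finset.sum_congr rfl fun b _ => ?_
  rw [← cylAt_ofFn, hν.measure_cylAt]

/-- If `ν ≤ c • μ` holds for the cylinders of infinitely many lengths, then it holds for every set
that is determined by finitely many coordinates. -/
theorem measure_le_of_window {μ ν : Measure Ω.carrier} (hμ : IsInvariantProb Ω μ)
    (hν : IsInvariantProb Ω ν) {c : ℝ≥0∞}
    (h : ∀ l : ℕ, ∃ n ≥ l, ∀ u : List (Fin m), u.length = n → ν (cyl Ω u) ≤ c * μ (cyl Ω u))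
    {l : ℕ} {A : Set Ω.carrier}
    (hA : ∀ ω ω' : Ω.carrier, (∀ j : ℤ, -l ≤ j → j ≤ l → ω.1 j = ω'.1 j) → ω ∈ A → ω' ∈ A) :
    ν A ≤ c * μ A := by
  classical
  -- The window from `-l` to `l` has `2 * l + 1` coordinates; a longer admissible window contains
  -- it.
  obtain ⟨n, hn, hcyl⟩ := h (2 * l + 1)
  set π := fun ω : Ω.carrier => fun j : Fin n => ω.1 (-l + (j : ℤ)) with hπ
  have hpre : A = π ⁻¹' ((π '' A).toFinset : Set (Fin n → Fin m)) := by
    rw [Set.coe_toFinset]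
    refine (Set.subset_preimage_image π A).antisymm ?_
    rintro ω ⟨ω', hω', heq⟩
    refine hA ω' ω (fun j hj hj' => ?_) hω'
    have := congrFun heq ⟨(j + l).toNat, by omega⟩
    simp only [hπ] at this
    rwa [show -(l : ℤ) + ((j + l).toNat : ℤ) = j by omega] at this
  have hmeas : ∀ b ∈ (π '' A).toFinset, MeasurableSet (π ⁻¹' {b}) :=
    fun b _ => measurable_factor _ _ (measurableSet_singleton b)
  rw [hpre, ← sum_measure_preimage_singleton _ hmeas, ← sum_measure_preimage_singleton _ hmeas,
    Finset.mul_sum]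
  refine Finset.sum_le_sum fun b _ => ?_
  rw [← cylAt_ofFn, hν.measure_cylAt, hμ.measure_cylAt]
  exact hcyl _ (by simp)

theorem measure_open_le {μ ν : Measure Ω.carrier} (hμ : IsInvariantProb Ω μ)
    (hν : IsInvariantProb Ω ν) {c : ℝ≥0∞}
    (h : ∀ l : ℕ, ∃ n ≥ l, ∀ u : List (Fin m), u.length = n → ν (cyl Ω u) ≤ c * μ (cyl Ω u))
    {U : Set Ω.carrier} (hU : IsOpen U) : ν U ≤ c * μ U := by
  -- The points whose window from `-l` to `l` already forces membership in `U`. These sets increase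
  -- to `U` because `U` is open in the product topology.
  let A : ℕ → Set Ω.carrier := fun l =>
    {ω | ∀ ω' : Ω.carrier, (∀ j : ℤ, -l ≤ j → j ≤ l → ω.1 j = ω'.1 j) → ω' ∈ U}
  have hmono : Monotone A := fun l l' hl ω hω ω' hω' =>
    hω ω' fun j hj hj' => hω' j (by omega) (by omega)
  have hAU : ∀ l, A l ⊆ U := fun l ω hω => hω ω fun _ _ _ => rfl
  have hUA : U = ⋃ l, A l := by
    refine Set.Subset.antisymm (fun ω hω => ?_) (Set.iUnion_subset hAU)
    obtain ⟨V, hV, rfl⟩ := isOpen_induced_iff.1 hU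
    obtain ⟨I, s, hs, hsV⟩ := isOpen_pi_iff.1 hV ω.1 hω
    refine Set.mem_iUnion.2 ⟨I.sup Int.natAbs, fun ω' hω' => hsV fun j hj => ?_⟩
    have := Finset.le_sup (f := Int.natAbs) hj
    rw [← hω' j (by omega) (by omega)]
    exact (hs j hj).2
  calc ν U = ⨆ l, ν (A l) := by rw [hUA, hmono.measure_iUnion]
    _ ≤ c * μ U := iSup_le fun l =>
      (measure_le_of_window hμ hν h (l := l) (A := A l) fun ω ω' heq hω ω'' h'' =>
        hω ω'' fun j hj hj' => (heq j hj hj').trans (h'' j hj hj')).trans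
      (mul_le_mul_right (measure_mono (hAU l)) c)

/-- Outer regularity of `c • μ`, which uses that `c` is finite, carries the bound from open sets to
all measurable sets. -/
theorem absolutelyContinuous_of_cyl_le {μ ν : Measure Ω.carrier} (hμ : IsInvariantProb Ω μ)
    (hν : IsInvariantProb Ω ν) {c : ℝ≥0∞} (hc : c ≠ ∞)
    (h : ∀ l : ℕ, ∃ n ≥ l, ∀ u : List (Fin m), u.length = n → ν (cyl Ω u) ≤ c * μ (cyl Ω u)) :
    ν ≪ μ := by
  have := hμ.1
  have : (c • μ).OuterRegular := Measure.OuterRegular.smul μ hc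
  refine Measure.absolutelyContinuous_of_le_smul (c := c) (Measure.le_intro fun A _ _ => ?_)
  rw [A.measure_eq_iInf_isOpen (c • μ)]
  exact le_iInf₂ fun U hAU => le_iInf fun hU =>
    (measure_mono hAU).trans (measure_open_le hμ hν h hU)

theorem exists_isInvariantProb [Nonempty Ω.carrier] :
    ∃ μ : Measure Ω.carrier, IsInvariantProb Ω μ := by
  have : CompactSpace Ω.carrier := isCompact_iff_compactSpace.1 Ω.isClosed.isCompact
  exact exists_measurePreserving_of_continuous (continuous_shift Ω)

/-! ### Estimates for the measures of cylinders -/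

namespace IsBispecialSequence

variable {w : ℕ → List (Fin m)} {i : ℕ → Fin m} {ν : Measure Ω.carrier}

/-- By `exists_occurs`, `(w n).length + 1` translates of the cylinder cover the subshift. -/
theorem one_le_measure (hΩ : IsArnouxRauzy Ω) (hw : IsBispecialSequence Ω w i)
    (hν : IsInvariantProb Ω ν) (n : ℕ) :
    1 ≤ (((w n).length + 1 : ℕ) : ℝ≥0∞) * ν (cyl Ω (w n)) := by
  have := hν.1
  calc (1 : ℝ≥0∞) = ν Set.univ := measure_univ.symm
    _ ≤ ν (⋃ d ∈ Finset.range ((w n).length + 1), cylAt Ω (0 - (d : ℕ)) (w n)) := by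
      refine measure_mono fun ω _ => ?_
      obtain ⟨d, hd, h⟩ := hw.exists_occurs hΩ n ω.2 0
      exact Set.mem_biUnion (Finset.mem_coe.2 (Finset.mem_range.2 (by omega))) h
    _ ≤ ∑ d ∈ Finset.range ((w n).length + 1), ν (cylAt Ω (0 - (d : ℕ)) (w n)) :=
      measure_biUnion_finset_le _ _
    _ = _ := by simp [hν.measure_cylAt]

theorem measure_le_two_mul (hΩ : IsArnouxRauzy Ω) (hw : IsBispecialSequence Ω w i)
    (hν : IsInvariantProb Ω ν) (n : ℕ) :
    ν (cyl Ω (w n)) ≤ 2 * ν (cyl Ω (w (n + 1))) := by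
  have hsub : cylAt Ω 0 (w n) ⊆ cylAt Ω 0 (w (n + 1)) ∪
      cylAt Ω (0 - ((w (n + 1)).length - (w n).length : ℕ)) (w (n + 1)) :=
    fun ω hω => hw.occurs_succ hΩ ω.2 hω
  have h := (measure_mono hsub).trans (measure_union_le (μ := ν) _ _)
  rwa [hν.measure_cylAt, hν.measure_cylAt, hν.measure_cylAt, ← two_mul] at h

theorem measure_le_two_pow_mul (hΩ : IsArnouxRauzy Ω) (hw : IsBispecialSequence Ω w i)
    (hν : IsInvariantProb Ω ν) (n j : ℕ) :
    ν (cyl Ω (w n)) ≤ 2 ^ j * ν (cyl Ω (w (n + j))) := by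
  induction j with
  | zero => simp
  | succ j ih =>
    calc ν (cyl Ω (w n)) ≤ 2 ^ j * ν (cyl Ω (w (n + j))) := ih
      _ ≤ 2 ^ j * (2 * ν (cyl Ω (w (n + j + 1)))) :=
        mul_le_mul_right (hw.measure_le_two_mul hΩ hν _) _
      _ = 2 ^ (j + 1) * ν (cyl Ω (w (n + (j + 1)))) := by
        rw [pow_succ, mul_assoc, add_assoc]

/-- The word `w (n + 1)` starts with `w n ++ [i n]`, and `w n` ends in `w k`. -/
theorem measure_index_le (hΩ : IsArnouxRauzy Ω) (hw : IsBispecialSequence Ω w i)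
    (hν : IsInvariantProb Ω ν) {k n : ℕ} (hkn : k ≤ n) :
    ν (cyl Ω (w (n + 1))) ≤ ν (cyl Ω (w k ++ [i n])) := by
  obtain ⟨t, ht⟩ := hw.exists_append_eq hΩ hkn
  obtain ⟨s, hs⟩ := hw.exists_index_append_eq hΩ n
  refine hν.measure_cyl_le t.length fun ω _ p hp => ?_
  rw [← hs, ← ht, List.append_assoc, List.append_assoc, occurs_append] at hp
  rw [← List.append_assoc] at hp
  exact (occurs_append.1 hp.2).1

variable {N k : ℕ}

theorem measure_bispecial_le_of_block (hΩ : IsArnouxRauzy Ω) (hw : IsBispecialSequence Ω w i)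
    (hν : IsInvariantProb Ω ν) (hblock : ∀ a, ∃ r < N, i (k + r) = a) {u : List (Fin m)}
    (hu : u ∈ words Ω) (hul : u.length = (w k).length + 1) :
    ν (cyl Ω (w k)) ≤ 2 ^ N * ν (cyl Ω u) := by
  obtain ⟨a, d, had⟩ := hw.exists_occurs_of_occurs_append hΩ k hu hul
  -- The forcing letter appears in the block as `i (k + r)`; descending to `w (k + r + 1)` costs `r
  -- + 1 ≤ N` factors of 2.
  obtain ⟨r, hr, rfl⟩ := hblock a
  calc ν (cyl Ω (w k)) ≤ 2 ^ (r + 1) * ν (cyl Ω (w (k + (r + 1)))) :=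
        hw.measure_le_two_pow_mul hΩ hν _ _
    _ ≤ 2 ^ N * ν (cyl Ω u) := by
      refine mul_le_mul' (pow_le_pow_right₀ (by norm_num) hr) ?_
      exact (hw.measure_index_le hΩ hν (Nat.le_add_right k r)).trans (hν.measure_cyl_le d had)

theorem measure_le_measure_bispecial (hΩ : IsArnouxRauzy Ω) (hw : IsBispecialSequence Ω w i)
    (hν : IsInvariantProb Ω ν) (k : ℕ) {u : List (Fin m)} (hul : (w k).length ≤ u.length) :
    ν (cyl Ω u) ≤ ν (cyl Ω (w k)) := by
  by_cases hu : u ∈ words Ω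
  · obtain ⟨d, hd⟩ := hw.exists_occurs_of_occurs hΩ k hu hul
    exact hν.measure_cyl_le (-d) hd
  · simp [cyl_eq_empty hu]

/-- The measures of `w k` with respect to two invariant measures are comparable. -/
theorem measure_bispecial_le (hΩ : IsArnouxRauzy Ω) (hw : IsBispecialSequence Ω w i)
    {μ : Measure Ω.carrier} (hμ : IsInvariantProb Ω μ)
    (hν : IsInvariantProb Ω ν) (hblock : ∀ a, ∃ r < N, i (k + r) = a) :
    ν (cyl Ω (w k)) ≤ 2 ^ N * μ (cyl Ω (w k)) := by
  classical
  -- The number of words of this length links the two measures: `F.card * ν (cyl Ω (w k))` is at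
  -- most `2 ^ N`, and the same product for `μ` is at least 1.
  set F : Finset (Fin ((w k).length + 1) → Fin m) :=
    Finset.univ.filter fun b => List.ofFn b ∈ words Ω with hF
  have hsum : ∀ {ρ : Measure Ω.carrier}, IsInvariantProb Ω ρ →
      ∑ b ∈ F, ρ (cyl Ω (List.ofFn b)) = 1 := fun {ρ} hρ => by
    rw [← hρ.sum_measure_cyl ((w k).length + 1)]
    refine Finset.sum_subset (Finset.subset_univ _) fun b _ hb => ?_
    rw [cyl_eq_empty (by simpa [hF] using hb), measure_empty]
  have h1 : (F.card : ℝ≥0∞) * ν (cyl Ω (w k)) ≤ 2 ^ N := by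
    calc (F.card : ℝ≥0∞) * ν (cyl Ω (w k)) = ∑ b ∈ F, ν (cyl Ω (w k)) := by simp
      _ ≤ ∑ b ∈ F, 2 ^ N * ν (cyl Ω (List.ofFn b)) := Finset.sum_le_sum fun b hb =>
        hw.measure_bispecial_le_of_block hΩ hν hblock (by simpa [hF] using hb) (by simp)
      _ = 2 ^ N := by rw [← Finset.mul_sum, hsum hν, mul_one]
  have h2 : 1 ≤ (F.card : ℝ≥0∞) * μ (cyl Ω (w k)) := by
    calc 1 = ∑ b ∈ F, μ (cyl Ω (List.ofFn b)) := (hsum hμ).symm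
      _ ≤ ∑ b ∈ F, μ (cyl Ω (w k)) := Finset.sum_le_sum fun b _ =>
        hw.measure_le_measure_bispecial hΩ hμ k (by simp)
      _ = _ := by simp
  calc ν (cyl Ω (w k)) ≤ ν (cyl Ω (w k)) * (F.card * μ (cyl Ω (w k))) := le_mul_of_one_le_right' h2
    _ = F.card * ν (cyl Ω (w k)) * μ (cyl Ω (w k)) := by ring
    _ ≤ 2 ^ N * μ (cyl Ω (w k)) := mul_le_mul_left h1 _

theorem measure_cyl_le_of_block (hΩ : IsArnouxRauzy Ω) (hw : IsBispecialSequence Ω w i)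
    {μ : Measure Ω.carrier} (hμ : IsInvariantProb Ω μ)
    (hν : IsInvariantProb Ω ν) (hblock : ∀ a, ∃ r < N, i (k + r) = a) {u : List (Fin m)}
    (hul : u.length = (w k).length + 1) :
    ν (cyl Ω u) ≤ 2 ^ N * 2 ^ N * μ (cyl Ω u) := by
  by_cases hu : u ∈ words Ω
  · calc ν (cyl Ω u) ≤ ν (cyl Ω (w k)) := hw.measure_le_measure_bispecial hΩ hν k (by omega)
      _ ≤ 2 ^ N * μ (cyl Ω (w k)) := hw.measure_bispecial_le hΩ hμ hν hblock
      _ ≤ 2 ^ N * (2 ^ N * μ (cyl Ω u)) :=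
        mul_le_mul_right (hw.measure_bispecial_le_of_block hΩ hμ hblock hu hul) _
      _ = _ := (mul_assoc _ _ _).symm
  · simp [cyl_eq_empty hu]

theorem two_pow_inv_le_eta (hΩ : IsArnouxRauzy Ω) (hw : IsBispecialSequence Ω w i)
    (hν : IsInvariantProb Ω ν) (hblock : ∀ a, ∃ r < N, i (k + r) = a) :
    ((2 : ℝ≥0∞) ^ N)⁻¹ ≤
      (((w k).length + 1 : ℕ) : ℝ≥0∞) * eta Ω ν ((w k).length + 1) := by
  have h2 : (2 : ℝ≥0∞) ^ N ≠ 0 := by simp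
  have h2' : (2 : ℝ≥0∞) ^ N ≠ ∞ := ENNReal.pow_ne_top (by simp)
  have heta : ((2 : ℝ≥0∞) ^ N)⁻¹ * ν (cyl Ω (w k)) ≤ eta Ω ν ((w k).length + 1) :=
    le_iInf₂ fun u hu => by
      rw [ENNReal.inv_mul_le_iff h2 h2']
      exact hw.measure_bispecial_le_of_block hΩ hν hblock hu.1 hu.2
  calc ((2 : ℝ≥0∞) ^ N)⁻¹
      ≤ ((2 : ℝ≥0∞) ^ N)⁻¹ * ((((w k).length + 1 : ℕ) : ℝ≥0∞) * ν (cyl Ω (w k))) :=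
        le_mul_of_one_le_right' (hw.one_le_measure hΩ hν k)
    _ = (((w k).length + 1 : ℕ) : ℝ≥0∞) * (((2 : ℝ≥0∞) ^ N)⁻¹ * ν (cyl Ω (w k))) := by ring
    _ ≤ _ := mul_le_mul_right heta _

end IsBispecialSequence

end ArnouxRauzy

/-! ### Unique ergodicity and condition (B) -/

theorem mainTheorem11 (m : ℕ) (hm : 2 ≤ m) (Ω : ArnouxRauzy.Subshift m)
    (hΩ : ArnouxRauzy.IsArnouxRauzy Ω)
    (i : ℕ → Fin m) (hi : ArnouxRauzy.IsIndexSequence Ω i)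
    (N : ℕ) (k : ℕ → ℕ) (hk : Tendsto k atTop atTop)
    (hblock : ∀ j : ℕ, ∀ a : Fin m, ∃ r < N, i (k j + r) = a) :
    ArnouxRauzy.ConditionB Ω ∧
    ∃ μ : Measure Ω.carrier,
      ArnouxRauzy.IsInvariantProb Ω μ ∧
      (∀ ν : Measure Ω.carrier, ArnouxRauzy.IsInvariantProb Ω ν → ν = μ) ∧
      ((2 : ℝ≥0∞) ^ N)⁻¹ ≤ ArnouxRauzy.limsupEta Ω μ := by
  obtain ⟨w, hrange, hmono, hleft⟩ := hi
  have hw : ArnouxRauzy.IsBispecialSequence Ω w i := ⟨hrange, hmono, hleft⟩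
  have hlarge : ∀ l : ℕ, ∃ j, l ≤ (w (k j)).length + 1 := fun l => by
    obtain ⟨j, hj⟩ := (hk.eventually_ge_atTop l).exists
    -- A strictly increasing sequence of natural numbers dominates its index, so the lengths are
    -- unbounded along `k`.
    have : k j ≤ (w (k j)).length := hmono.le_apply
    exact ⟨j, by omega⟩
  have hac : ∀ ν₁ ν₂ : Measure Ω.carrier, IsProbabilityMeasure ν₁ →
      MeasurePreserving (ArnouxRauzy.shift Ω) ν₁ ν₁ → IsProbabilityMeasure ν₂ →
      MeasurePreserving (ArnouxRauzy.shift Ω) ν₂ ν₂ → ν₁ ≪ ν₂ := by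
    intro ν₁ ν₂ h₁ h₁' h₂ h₂'
    refine ArnouxRauzy.absolutelyContinuous_of_cyl_le ⟨h₂, h₂'⟩ ⟨h₁, h₁'⟩
      (c := 2 ^ N * 2 ^ N) ?_ fun l => ?_
    · exact ENNReal.mul_ne_top (ENNReal.pow_ne_top (by simp)) (ENNReal.pow_ne_top (by simp))
    · obtain ⟨j, hj⟩ := hlarge l
      exact ⟨_, hj, fun u hu => hw.measure_cyl_le_of_block hΩ ⟨h₂, h₂'⟩ ⟨h₁, h₁'⟩ (hblock j) hu⟩
  have := hΩ.nonempty
  obtain ⟨μ, hμ⟩ := ArnouxRauzy.exists_isInvariantProb (Ω := Ω)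
  have := hμ.1
  have herg : Ergodic (ArnouxRauzy.shift Ω) μ := ergodic_of_forall_absolutelyContinuous hμ.2 hac
  have hlim : ((2 : ℝ≥0∞) ^ N)⁻¹ ≤ ArnouxRauzy.limsupEta Ω μ := by
    refine le_limsup_of_frequently_le (frequently_atTop.2 fun l => ?_)
    obtain ⟨j, hj⟩ := hlarge l
    exact ⟨_, hj, hw.two_pow_inv_le_eta hΩ hμ (hblock j)⟩
  refine ⟨⟨μ, hμ.1, herg, lt_of_lt_of_le ?_ hlim⟩, μ, hμ, fun ν hν => ?_, hlim⟩
  · exact ENNReal.inv_pos.2 (ENNReal.pow_ne_top (by simp))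
  · have := hν.1
    -- An invariant probability measure absolutely continuous with respect to an ergodic one equals
    -- it.
    exact herg.eq_of_absolutelyContinuous hν.2 (hac ν μ hν.1 hν.2 hμ.1 hμ.2)
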